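/- Let $n\ge 2$ and work in $\mathbb{P}^n=\mathbb{P}^n_{\mathbb{C}}$ with homogeneous coordinates $x_0,\dots,x_n$. For an integer $i$ let $\Delta_i\subset\mathbb{P}^n$ be the set of points with at most $i+1$ non-zero coordinates. For a finite set $\mathbb{X}\subset\mathbb{P}^n$ and $r\ge 1$ let $$\mathbb{X}^{\underline{\star} r}=\{P_1\star\cdots\star P_r \mid P_1,\dots,P_r\in\mathbb{X} \text{ pairwise distinct, and } P_1\star\cdots\star P_r \text{ is defined}\}$$ be its $r$-th square-free Hadamard power, where $P_1\star\cdots\star P_r$ is the point obtained by multiplying homogeneous coordinates entrywise (defined if the resulting vector is non-zero). A finite set $\mathcal{L}=\{L_1,\dots,L_r\}$ of linear forms in $\mathbb{C}[x_0,\dots,x_n]$ is generally linear if $r\ge n+1$ and any $n+1$ distinct elements of $\mathcal{L}$ are linearly independent. It is a strong Hadamard set if there are a linear form $L=a_0x_0+\cdots+a_nx_n$ and points $Q_i=[q_0(i):\cdots:q_n(i)]$, $1\le i\le r$, with all coordinates non-zero, such that for every $i$ the form $L_i$ is non-zero and is a non-zero scalar multiple of $\sum_{j=0}^n \frac{a_j}{q_j(i)}x_j$,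 and $\sum_{j=0}^n a_jq_j(i)=0$. A subset of $\mathbb{P}^n$ is a Hadamard star configuration if it equals $$\mathbb{X}_c(\mathcal{L})=\bigcup_{1\le i_1<\cdots<i_c\le r}V(L_{i_1},\dots,L_{i_c})$$ for some $1\le c\le n$ and some generally linear strong Hadamard set $\mathcal{L}$. **Theorem.** Let $\ell$ be a line in $\mathbb{P}^n$ such that $\ell\cap\Delta_{n-2}=\emptyset$, and let $\mathbb{X}\subset\ell$ be a set of $m>n$ points (with $m$ finite) such that $\mathbb{X}\cap\Delta_{n-1}=\emptyset$. (i) If $[1:1:\cdots:1]\in\ell$, then $\mathbb{X}^{\underline{\star} n}$ is a Hadamard star configuration. (ii) If $n=2$, then $\mathbb{X}^{\underline{\star} 2}$ is a Hadamard star configuration. -/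

import Mathlib

open scoped LinearAlgebra.Projectivization

namespace HadamardStar

/-- Complex projective `n`-space, with homogeneous coordinates indexed by `0, …, n`. -/
abbrev PSpace (n : ℕ) : Type := ℙ ℂ (Fin (n + 1) → ℂ)

/-- The degree one piece of `ℂ[x_0, …, x_n]`: linear forms on `ℂ^(n+1)`. -/
abbrev LinForm (n : ℕ) : Type := Module.Dual ℂ (Fin (n + 1) → ℂ)

/-- The linear form `a_0 x_0 + ⋯ + a_n x_n`. -/
def linForm {n : ℕ} (a : Fin (n + 1) → ℂ) : LinForm n :=
  ∑ j, a j • (LinearMap.proj j : (Fin (n + 1) → ℂ) →ₗ[ℂ] ℂ)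

theorem linForm_apply {n : ℕ} (a v : Fin (n + 1) → ℂ) :
    linForm a v = ∑ j, a j * v j := by
  simp [linForm]

/-- The locus in projective space where all the linear forms in `T` vanish. Vanishing does not
depend on the chosen representative of a point. -/
def zeroLocus {n : ℕ} (T : Finset (LinForm n)) : Set (PSpace n) :=
  {P | ∀ L ∈ T, L P.rep = 0}

/-- At least `n + 1` linear forms, any `n + 1` distinct ones of which are linearly independent. -/
def GenerallyLinear {n : ℕ} (𝓛 : Finset (LinForm n)) : Prop :=
  n + 1 ≤ 𝓛.card ∧
    ∀ T ⊆ 𝓛, T.card = n + 1 → LinearIndepOn ℂ id (T : Set (LinForm n))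

/-- The union of the loci `V(L_{i_1}, …, L_{i_c})` over all choices of `c` distinct members
of `𝓛`. -/
def starVariety {n : ℕ} (c : ℕ) (𝓛 : Finset (LinForm n)) : Set (PSpace n) :=
  ⋃ T ∈ 𝓛.powersetCard c, zeroLocus T

open Classical in
/-- `Δ_i`: the points of projective `n`-space with at most `i + 1` non-zero coordinates. -/
def coordDelta (n : ℕ) (i : ℤ) : Set (PSpace n) :=
  {P | ((Finset.univ.filter fun j => P.rep j ≠ 0).card : ℤ) ≤ i + 1}

/-- `𝓛` is a Hadamard set with respect to the linear form `∑ a_j x_j` and the points `P_M`, one for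
each `M ∈ 𝓛`: no `P_M` has a zero coordinate, and `[M] = [∑ (a_j / p_j) x_j]` in the projective
space of linear forms, where `P_M = [p_0 : ⋯ : p_n]`. The right-hand side does not depend on
the representative of `P_M`. -/
def IsHadamardSetFor {n : ℕ} (𝓛 : Finset (LinForm n)) (a : Fin (n + 1) → ℂ)
    (P : 𝓛 → PSpace n) : Prop :=
  ∀ M : 𝓛, P M ∉ coordDelta n ((n : ℤ) - 1) ∧
    ∃ (hM : (M : LinForm n) ≠ 0) (hL : linForm (fun j => a j / (P M).rep j) ≠ 0),
      Projectivization.mk ℂ (M : LinForm n) hM =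
        Projectivization.mk ℂ (linForm fun j => a j / (P M).rep j) hL

/-- `𝓛` is a Hadamard set for some `∑ a_j x_j` and some points `P_M`, and in addition
`∑ a_j x_j` vanishes at every `P_M`. -/
def IsStrongHadamardSet {n : ℕ} (𝓛 : Finset (LinForm n)) : Prop :=
  ∃ (a : Fin (n + 1) → ℂ) (P : 𝓛 → PSpace n),
    IsHadamardSetFor 𝓛 a P ∧ ∀ M : 𝓛, ∑ j, a j * (P M).rep j = 0

/-- A set of the form `𝕏_c(𝓛)`, where `1 ≤ c ≤ n` and `𝓛` is generally linear and a strong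
Hadamard set. -/
def IsHadamardStarConfiguration {n : ℕ} (Z : Set (PSpace n)) : Prop :=
  ∃ (c : ℕ) (𝓛 : Finset (LinForm n)), 1 ≤ c ∧ c ≤ n ∧
    GenerallyLinear 𝓛 ∧ IsStrongHadamardSet 𝓛 ∧ Z = starVariety c 𝓛

/-- The point `P_1 ⋆ ⋯ ⋆ P_r` exists and equals `Q`: the coordinatewise product of representatives
is not the zero vector, and it represents `Q`. -/
def IsHadamardProduct {n r : ℕ} (P : Fin r → PSpace n) (Q : PSpace n) : Prop :=
  ∃ h : (fun j => ∏ i, (P i).rep j) ≠ 0, Q = Projectivization.mk ℂ (fun j => ∏ i, (P i).rep j) h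

/-- The square-free Hadamard power: all products `P_1 ⋆ ⋯ ⋆ P_r` of pairwise distinct points
of `X`. -/
def sqFreeHadamardPower {n : ℕ} (X : Set (PSpace n)) (r : ℕ) : Set (PSpace n) :=
  {Q | ∃ P : Fin r → PSpace n, Function.Injective P ∧ (∀ i, P i ∈ X) ∧ IsHadamardProduct P Q}

/-- A line: a linear subspace of projective dimension one. -/
def IsLine {n : ℕ} (ℓ : Projectivization.Subspace ℂ (Fin (n + 1) → ℂ)) : Prop :=
  Module.finrank ℂ (Projectivization.Subspace.submodule ℓ) = 2

/-- The point `[1 : ⋯ : 1]`. -/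
noncomputable def onesPoint (n : ℕ) : PSpace n := Projectivization.mk ℂ (fun _ => 1) one_ne_zero

end HadamardStar

namespace HadamardStar

/-! Write n = m + 1 and let W be the plane in ℂ^(n+1) over ℓ, with entrywise products. W ^ m is
spanned by m + 1 monomials, so a non-zero form `a` in m + 2 variables kills it. Since ℓ misses
Δ_{n-2}, W contains for each k a vector vanishing at coordinate k only; products of these force
every a_j ≠ 0. For P in X put L_P = ∑ (a_j / p_j) x_j. As L_P(p * y) = a(y), L_P kills every product
of n distinct points of X that includes P, and it kills no other (`twistedForm_prod_ne_zero`). This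
duality makes any n + 1 of the L_P independent (`linearIndepOn_form`) and the common zero of n of
them the product of their points (`eq_smul_prod`). The strong condition a(p) = 0 follows from W ≤ W
^ m, which holds if 1 ∈ W or m = 1: the two cases of the theorem. -/

/-- No non-zero vector of `W` has two vanishing coordinates. -/
def AvoidsCodimTwo {n : ℕ} (W : Submodule ℂ (Fin (n + 1) → ℂ)) : Prop :=
  ∀ w ∈ W, w ≠ 0 → ∀ j k, j ≠ k → w j = 0 → w k ≠ 0

/-- The linear form `∑ (a_j / p_j) x_j`. -/
noncomputable def twistedForm {n : ℕ} (a p : Fin (n + 1) → ℂ) : LinForm n := linForm fun j => a j / p j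

theorem twistedForm_mul {n : ℕ} (a : Fin (n + 1) → ℂ) {p : Fin (n + 1) → ℂ} (hp : ∀ j, p j ≠ 0)
    (y : Fin (n + 1) → ℂ) : twistedForm a p (p * y) = linForm a y := by
  simp only [twistedForm, linForm_apply, Pi.mul_apply]
  refine Finset.sum_congr rfl fun j _ => ?_
  field_simp [hp j]

theorem linForm_single {n : ℕ} (a : Fin (n + 1) → ℂ) (j : Fin (n + 1)) :
    linForm a (Pi.single j 1) = a j := by
  simp [linForm_apply, Pi.single_apply]

theorem linForm_injective {n : ℕ} : Function.Injective (linForm (n := n)) := by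
  intro a b h
  funext j
  rw [← linForm_single a, h, linForm_single]

theorem exists_eq_linForm {n : ℕ} (f : LinForm n) : ∃ a, f = linForm a := by
  refine ⟨fun j => f (Pi.single j 1), LinearMap.pi_ext' fun j => LinearMap.ext_ring ?_⟩
  simp [linForm_single]

/-! ### Entrywise powers of a plane and the form annihilating them -/

theorem prod_mem_pow {A ι : Type*} [CommRing A] [Algebra ℂ A] {W : Submodule ℂ A}
    (s : Finset ι) (w : ι → A) (hw : ∀ i ∈ s, w i ∈ W) : ∏ i ∈ s, w i ∈ W ^ s.card := by
  classical
  induction s using Finset.induction_on with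
  | empty => simpa using Submodule.one_le.1 (le_refl (1 : Submodule ℂ A))
  | insert i s hi ih =>
    rw [Finset.prod_insert hi, Finset.card_insert_of_notMem hi, pow_succ']
    exact Submodule.mul_mem_mul (hw i (Finset.mem_insert_self _ _))
      (ih fun k hk => hw k (Finset.mem_insert_of_mem hk))

theorem span_pair_pow_le {A : Type*} [CommRing A] [Algebra ℂ A] (u v : A) (k : ℕ) :
    Submodule.span ℂ {u, v} ^ k ≤
      Submodule.span ℂ (Set.range fun i : Fin (k + 1) => u ^ (i : ℕ) * v ^ (k - i)) := by
  induction k with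
  | zero => simp [Submodule.one_eq_span]
  | succ k ih =>
    rw [pow_succ]
    refine (mul_le_mul_left ih _).trans ?_
    rw [Submodule.span_mul_span]
    refine Submodule.span_mono ?_
    rintro _ ⟨_, ⟨i, rfl⟩, w, hw, rfl⟩
    rcases hw with rfl | rfl
    · refine ⟨i.succ, ?_⟩
      simp only [Fin.val_succ, Nat.add_sub_add_right]
      ring
    · refine ⟨i.castSucc, ?_⟩
      simp only [Fin.val_castSucc]
      rw [Nat.succ_sub (Nat.lt_succ_iff.1 i.2), pow_succ, mul_assoc]

theorem finrank_pow_le {A : Type*} [CommRing A] [Algebra ℂ A] {W : Submodule ℂ A}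
    (hW : Module.finrank ℂ W = 2) (k : ℕ) : Module.finrank ℂ ↥(W ^ k) ≤ k + 1 := by
  have : Module.Finite ℂ W := Module.finite_of_finrank_pos (by omega)
  let b := Module.finBasisOfFinrankEq ℂ W hW
  have hspan : W = Submodule.span ℂ {(b 0 : A), (b 1 : A)} := by
    have h := congrArg (Submodule.map W.subtype) b.span_eq
    rw [Submodule.map_span, Submodule.map_top, Submodule.range_subtype] at h
    refine h.symm.trans (congrArg (Submodule.span ℂ) ?_)
    ext x
    simp [Fin.exists_fin_two, eq_comm]
  have hle := span_pair_pow_le (b 0 : A) (b 1 : A) k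
  rw [← hspan] at hle
  have : Module.Finite ℂ (Submodule.span ℂ
      (Set.range fun i : Fin (k + 1) => (b 0 : A) ^ (i : ℕ) * (b 1 : A) ^ (k - i))) :=
    Module.Finite.span_of_finite _ (Set.finite_range _)
  exact (Submodule.finrank_mono hle).trans ((finrank_range_le_card _).trans (by simp))

theorem AvoidsCodimTwo.exists_vanishing {n : ℕ} {W : Submodule ℂ (Fin (n + 1) → ℂ)}
    (hW : Module.finrank ℂ W = 2) (hA : AvoidsCodimTwo W) (k : Fin (n + 1)) :
    ∃ w ∈ W, w k = 0 ∧ ∀ j, j ≠ k → w j ≠ 0 := by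
  let f : W →ₗ[ℂ] ℂ := (LinearMap.proj k : (Fin (n + 1) → ℂ) →ₗ[ℂ] ℂ).comp W.subtype
  have hker : LinearMap.ker f ≠ ⊥ := LinearMap.ker_ne_bot_of_finrank_lt (by simp [hW])
  obtain ⟨w, hw, hw0⟩ := Submodule.exists_mem_ne_zero_of_ne_bot hker
  have hwk : (w : Fin (n + 1) → ℂ) k = 0 := hw
  exact ⟨w, w.2, hwk, fun j hj => hA w w.2 (by simpa using hw0) k j hj.symm hwk⟩

/-- Multiply, over k in s, vectors of W that vanish at coordinate k only. -/
theorem AvoidsCodimTwo.exists_vanishing_on {n : ℕ} {W : Submodule ℂ (Fin (n + 1) → ℂ)}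
    (hW : Module.finrank ℂ W = 2) (hA : AvoidsCodimTwo W) (s : Finset (Fin (n + 1))) :
    ∃ x ∈ W ^ s.card, ∀ j, x j = 0 ↔ j ∈ s := by
  choose e he h0 h1 using hA.exists_vanishing hW
  refine ⟨∏ k ∈ s, e k, prod_mem_pow s e fun i _ => he i, fun j => ?_⟩
  rw [Finset.prod_apply, Finset.prod_eq_zero_iff]
  constructor
  · rintro ⟨k, hk, h⟩
    by_cases hjk : j = k
    · exact hjk ▸ hk
    · exact absurd h (h1 k j hjk)
  · exact fun hj => ⟨j, hj, h0 j⟩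

theorem AvoidsCodimTwo.eq_zero_of_forall_pow {n : ℕ} {W : Submodule ℂ (Fin (n + 1) → ℂ)}
    (hW : Module.finrank ℂ W = 2) (hA : AvoidsCodimTwo W) {b : Fin (n + 1) → ℂ}
    (hb : ∀ x ∈ W ^ n, linForm b x = 0) : b = 0 := by
  funext j
  obtain ⟨x, hx, h⟩ := hA.exists_vanishing_on hW (Finset.univ.erase j)
  have hsum := hb x (by simpa using hx)
  rw [linForm_apply, Finset.sum_eq_single j] at hsum
  · exact (mul_eq_zero.1 hsum).resolve_right (by simp [h])
  · intro k _ hk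
    rw [(h k).2 (by simpa using hk), mul_zero]
  · simp

/-- The form exists because dim W ^ m ≤ m + 1 < m + 2. If a_j = 0, testing it on a product whose
only non-zero coordinates are j and l gives a_l = 0 for every l. -/
theorem AvoidsCodimTwo.exists_annihilator {m : ℕ} {W : Submodule ℂ (Fin (m + 1 + 1) → ℂ)}
    (hW : Module.finrank ℂ W = 2) (hA : AvoidsCodimTwo W) :
    ∃ a : Fin (m + 1 + 1) → ℂ, (∀ x ∈ W ^ m, linForm a x = 0) ∧ ∀ j, a j ≠ 0 := by
  have hlt : W ^ m < ⊤ := by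
    refine lt_top_iff_ne_top.2 fun h => ?_
    have := finrank_pow_le hW m
    rw [h, finrank_top, Module.finrank_fin_fun] at this
    omega
  obtain ⟨f, hf0, hf⟩ := Submodule.exists_le_ker_of_lt_top _ hlt
  obtain ⟨a, rfl⟩ := exists_eq_linForm f
  refine ⟨a, fun x hx => hf hx, fun j hj => hf0 ?_⟩
  suffices a = 0 by subst this; ext; simp [linForm_apply]
  funext l
  rcases eq_or_ne l j with rfl | hlj
  · exact hj
  obtain ⟨x, hx, h⟩ := hA.exists_vanishing_on hW ((Finset.univ.erase j).erase l)
  have hcard : ((Finset.univ.erase j).erase l : Finset (Fin (m + 1 + 1))).card = m := by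
    rw [Finset.card_erase_of_mem (by simpa using hlj), Finset.card_erase_of_mem (by simp)]
    simp
  rw [hcard] at hx
  have hsum : linForm a x = 0 := hf hx
  rw [linForm_apply, Finset.sum_eq_single l] at hsum
  · exact (mul_eq_zero.1 hsum).resolve_right (by simp [h])
  · intro k _ hk
    rcases eq_or_ne k j with rfl | hkj
    · rw [hj, zero_mul]
    · rw [(h k).2 (by simp [hk, hkj]), mul_zero]
  · simp

/-! ### Values of twisted forms on products -/

theorem mem_span_pair_of_finrank {E : Type*} [AddCommGroup E] [Module ℂ E] {W : Submodule ℂ E}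
    (hW : Module.finrank ℂ W = 2) {p q : E} (hp : p ∈ W) (hq : q ∈ W)
    (hpq : LinearIndependent ℂ ![p, q]) {w : E} (hw : w ∈ W) :
    ∃ α β : ℂ, α • p + β • q = w := by
  have : Module.Finite ℂ W := Module.finite_of_finrank_pos (by omega)
  have hle : Submodule.span ℂ {p, q} ≤ W := by
    rw [Submodule.span_le]
    rintro x (rfl | rfl) <;> assumption
  have heq : Submodule.span ℂ {p, q} = W := by
    refine Submodule.eq_of_le_of_finrank_eq hle ?_
    have := finrank_span_eq_card hpq
    rw [Matrix.range_cons, Matrix.range_cons, Matrix.range_empty, Set.union_empty,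
      Set.singleton_union] at this
    rw [this, hW, Fintype.card_fin]
  rw [← heq] at hw
  exact Submodule.mem_span_pair.1 hw

/-- A twisted form killing a product of points other than its own kills all products of vectors
of `W`. -/
theorem twistedForm_prod_eq_zero {m : ℕ} {W : Submodule ℂ (Fin (m + 1 + 1) → ℂ)}
    (hW : Module.finrank ℂ W = 2) {a : Fin (m + 1 + 1) → ℂ}
    (ha : ∀ x ∈ W ^ m, linForm a x = 0) {p : Fin (m + 1 + 1) → ℂ} (hp : p ∈ W)
    (hp0 : ∀ j, p j ≠ 0) {ι : Type*} {s : Finset ι} (hs : s.card = m + 1)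
    (q : ι → Fin (m + 1 + 1) → ℂ) (hq : ∀ i ∈ s, q i ∈ W)
    (hpq : ∀ i ∈ s, LinearIndependent ℂ ![p, q i]) (h0 : twistedForm a p (∏ i ∈ s, q i) = 0)
    (w : ι → Fin (m + 1 + 1) → ℂ) (hw : ∀ i, w i ∈ W) :
    twistedForm a p (∏ i ∈ s, w i) = 0 := by
  classical
  -- The factors q_i are exchanged for w_i one at a time; t records those already exchanged.
  suffices H : ∀ t ⊆ s, twistedForm a p (∏ i ∈ s, if i ∈ t then w i else q i) = 0 by
    rw [← H s subset_rfl]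
    congr 1
    exact Finset.prod_congr rfl fun i hi => by simp [hi]
  intro t
  induction t using Finset.induction_on with
  | empty => intro _; simpa using h0
  | insert i t hi ih =>
    intro hts
    have his : i ∈ s := hts (Finset.mem_insert_self _ _)
    have ih' := ih fun k hk => hts (Finset.mem_insert_of_mem hk)
    -- In w_i = αp + βq_i, the p part contributes α a(y) with y in W ^ m, and the q_i part is the
    -- induction hypothesis.
    obtain ⟨α, β, hαβ⟩ := mem_span_pair_of_finrank hW hp (hq i his) (hpq i his) (hw i)
    set y := ∏ k ∈ s.erase i, if k ∈ t then w k else q k with hy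
    have hyW : y ∈ W ^ m := by
      have := prod_mem_pow (W := W) (s.erase i) (fun k => if k ∈ t then w k else q k) fun k hk => by
        split_ifs
        · exact hw k
        · exact hq k (Finset.mem_of_mem_erase hk)
      rwa [Finset.card_erase_of_mem his, hs, Nat.add_sub_cancel] at this
    rw [← Finset.mul_prod_erase s _ his] at ih' ⊢
    have hy' : (∏ k ∈ s.erase i, if k ∈ insert i t then w k else q k) = y :=
      Finset.prod_congr rfl fun k hk => by simp [Finset.ne_of_mem_erase hk]
    rw [hy', if_pos (Finset.mem_insert_self _ _), ← hαβ, add_mul, smul_mul_assoc, smul_mul_assoc,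
      map_add, map_smul, map_smul, twistedForm_mul a hp0, ha y hyW]
    rw [← hy, if_neg hi] at ih'
    rw [ih']
    simp

/-- Otherwise the form would kill all (m + 1)-fold products from W, including one supported at
coordinate 0 alone, where its coefficient a_0 / p_0 is non-zero. -/
theorem AvoidsCodimTwo.twistedForm_prod_ne_zero {m : ℕ}
    {W : Submodule ℂ (Fin (m + 1 + 1) → ℂ)}
    (hW : Module.finrank ℂ W = 2) (hA : AvoidsCodimTwo W) {a : Fin (m + 1 + 1) → ℂ}
    (ha : ∀ x ∈ W ^ m, linForm a x = 0) (ha0 : ∀ j, a j ≠ 0) {p : Fin (m + 1 + 1) → ℂ}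
    (hp : p ∈ W) (hp0 : ∀ j, p j ≠ 0) {ι : Type*} {s : Finset ι} (hs : s.card = m + 1)
    (q : ι → Fin (m + 1 + 1) → ℂ) (hq : ∀ i ∈ s, q i ∈ W)
    (hpq : ∀ i ∈ s, LinearIndependent ℂ ![p, q i]) :
    twistedForm a p (∏ i ∈ s, q i) ≠ 0 := by
  intro h0
  have hprod := twistedForm_prod_eq_zero hW ha hp hp0 hs q hq hpq h0
  choose e he hez hen using hA.exists_vanishing hW
  have hcard : s.card = ((Finset.univ : Finset (Fin (m + 1 + 1))).erase 0).card := by simp [hs]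
  obtain ⟨g⟩ : Nonempty (s ≃ ((Finset.univ : Finset (Fin (m + 1 + 1))).erase 0)) :=
    ⟨Finset.equivOfCardEq hcard⟩
  classical
  -- The value 0 off s never enters the product; it only keeps the family inside W.
  have h := hprod (fun i => if hi : i ∈ s then e (g ⟨i, hi⟩) else 0) fun i => by
    split_ifs
    · exact he _
    · exact W.zero_mem
  have hre : (∏ i ∈ s, if hi : i ∈ s then e (g ⟨i, hi⟩) else 0) =
      ∏ k ∈ (Finset.univ : Finset (Fin (m + 1 + 1))).erase 0, e k := by
    rw [← Finset.prod_attach s, ← Finset.prod_coe_sort _ e, ← g.prod_comp]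
    exact Finset.prod_congr rfl fun i _ => by simp
  rw [hre, twistedForm, linForm_apply, Finset.sum_eq_single 0] at h
  · rw [Finset.prod_apply, mul_eq_zero, div_eq_zero_iff, Finset.prod_eq_zero_iff] at h
    rcases h with (h | h) | ⟨k, hk, h⟩
    · exact ha0 0 h
    · exact hp0 0 h
    · exact hen k 0 (Finset.ne_of_mem_erase hk).symm h
  · intro j _ hj
    rw [Finset.prod_apply, Finset.prod_eq_zero (f := fun k => e k j)
      (Finset.mem_erase.2 ⟨hj, Finset.mem_univ j⟩) (hez j), mul_zero]
  · simp

/-! ### The star configuration attached to points of a line -/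

/-- A finite set of points of the line `W` without zero coordinates, and a form vanishing on
`W ^ m`. -/
structure PointsOnLine {m : ℕ} (W : Submodule ℂ (Fin (m + 1 + 1) → ℂ))
    (a : Fin (m + 1 + 1) → ℂ) (X : Finset (PSpace (m + 1))) : Prop where
  finrank : Module.finrank ℂ W = 2
  avoids : AvoidsCodimTwo W
  annihilates : ∀ x ∈ W ^ m, linForm a x = 0
  coeff_ne_zero : ∀ j, a j ≠ 0
  rep_mem : ∀ P ∈ X, P.rep ∈ W
  rep_ne_zero : ∀ P ∈ X, ∀ j, P.rep j ≠ 0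

namespace PointsOnLine

variable {m : ℕ} {W : Submodule ℂ (Fin (m + 1 + 1) → ℂ)} {a : Fin (m + 1 + 1) → ℂ}
  {X : Finset (PSpace (m + 1))}

theorem form_prod_eq_zero (h : PointsOnLine W a X) {S : Finset (PSpace (m + 1))} (hS : S ⊆ X)
    (hcard : S.card = m + 1) {P : PSpace (m + 1)} (hP : P ∈ S) :
    twistedForm a P.rep (∏ Q ∈ S, Q.rep) = 0 := by
  classical
  rw [← Finset.mul_prod_erase S _ hP, twistedForm_mul a (h.rep_ne_zero P (hS hP))]
  refine h.annihilates _ ?_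
  have := prod_mem_pow (W := W) (S.erase P) (fun Q => Q.rep)
    fun Q hQ => h.rep_mem Q (hS (Finset.mem_of_mem_erase hQ))
  rwa [Finset.card_erase_of_mem hP, hcard, Nat.add_sub_cancel] at this

theorem form_prod_ne_zero (h : PointsOnLine W a X) {S : Finset (PSpace (m + 1))} (hS : S ⊆ X)
    (hcard : S.card = m + 1) {P : PSpace (m + 1)} (hPX : P ∈ X) (hP : P ∉ S) :
    twistedForm a P.rep (∏ Q ∈ S, Q.rep) ≠ 0 := by
  refine h.avoids.twistedForm_prod_ne_zero h.finrank h.annihilates h.coeff_ne_zero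
    (h.rep_mem P hPX) (h.rep_ne_zero P hPX) hcard _ (fun Q hQ => h.rep_mem Q (hS hQ))
    fun Q hQ => ?_
  rw [Projectivization.linearIndependent_pair_iff_ne]
  rintro rfl
  exact hP hQ

theorem form_injOn (h : PointsOnLine W a X) :
    Set.InjOn (fun P : PSpace (m + 1) => twistedForm a P.rep) X := by
  intro P hP Q hQ hPQ
  have hrep : P.rep = Q.rep := by
    funext j
    have := congrFun (linForm_injective hPQ) j
    have h1 := h.rep_ne_zero P hP j
    have h2 := h.rep_ne_zero Q hQ j
    have h3 := h.coeff_ne_zero j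
    field_simp at this
    exact this.symm
  rw [← P.mk_rep, ← Q.mk_rep]
  simp only [hrep]

/-- Evaluating a relation at the product of S without P leaves only the term of P. -/
theorem linearIndepOn_form (h : PointsOnLine W a X) {S : Finset (PSpace (m + 1))} (hS : S ⊆ X)
    (hcard : S.card = m + 1 + 1) :
    LinearIndepOn ℂ (fun P : PSpace (m + 1) => twistedForm a P.rep) (S : Set (PSpace (m + 1))) := by
  classical
  rw [linearIndepOn_finset_iff]
  intro c hc P hP
  have hSP : S.erase P ⊆ X := (Finset.erase_subset _ _).trans hS
  have hcardP : (S.erase P).card = m + 1 := by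
    rw [Finset.card_erase_of_mem hP, hcard, Nat.add_sub_cancel]
  have := congrArg (fun f : LinForm (m + 1) => f (∏ Q ∈ S.erase P, Q.rep)) hc
  simp only [LinearMap.sum_apply, LinearMap.smul_apply, LinearMap.zero_apply] at this
  rw [Finset.sum_eq_single P] at this
  · exact (mul_eq_zero.1 this).resolve_right
      (h.form_prod_ne_zero hSP hcardP (hS hP) (Finset.notMem_erase P S))
  · intro Q hQ hQP
    rw [h.form_prod_eq_zero hSP hcardP (Finset.mem_erase.2 ⟨hQP, hQ⟩), smul_zero]
  · exact fun hP' => absurd hP hP'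

open Classical in
/-- The twisted forms attached to the points of `X`. -/
noncomputable def forms (a : Fin (m + 1 + 1) → ℂ) (X : Finset (PSpace (m + 1))) :
    Finset (LinForm (m + 1)) :=
  X.image fun P => twistedForm a P.rep

theorem exists_subset_of_subset_forms (h : PointsOnLine W a X) {T : Finset (LinForm (m + 1))}
    (hT : T ⊆ forms a X) : ∃ S ⊆ X, S.card = T.card ∧ T = forms a S := by
  classical
  obtain ⟨S, hS, rfl⟩ := Finset.subset_image_iff.1 hT
  exact ⟨S, hS, (Finset.card_image_of_injOn (h.form_injOn.mono hS)).symm, rfl⟩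

theorem card_forms (h : PointsOnLine W a X) : (forms a X).card = X.card := by
  classical
  exact Finset.card_image_of_injOn h.form_injOn

theorem generallyLinear (h : PointsOnLine W a X) (hX : m + 1 < X.card) :
    GenerallyLinear (forms a X) := by
  classical
  refine ⟨by rw [h.card_forms]; exact hX, fun T hT hcard => ?_⟩
  obtain ⟨S, hS, hST, rfl⟩ := h.exists_subset_of_subset_forms hT
  have := (h.linearIndepOn_form hS (hST.trans hcard)).id_image
  simpa [forms] using this

theorem isStrongHadamardSet (h : PointsOnLine W a X) (hle : W ≤ W ^ m) :
    IsStrongHadamardSet (forms a X) := by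
  classical
  have hex : ∀ M : forms a X, ∃ P ∈ X, twistedForm a P.rep = M := fun M => by
    simpa [forms] using M.2
  choose P hPX hP using hex
  refine ⟨a, P, fun M => ⟨?_, ?_⟩, fun M => ?_⟩
  · have : (Finset.univ.filter fun j => (P M).rep j ≠ 0) = Finset.univ :=
      Finset.filter_true_of_mem fun j _ => h.rep_ne_zero _ (hPX M) j
    simp only [coordDelta, Set.mem_ofPred_eq, not_le]
    rw [Finset.filter_congr_decidable, this]
    simp
  · have hne : linForm (fun j => a j / (P M).rep j) ≠ 0 := by
      intro h0
      have := linForm_single (fun j => a j / (P M).rep j) 0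
      rw [h0] at this
      exact div_ne_zero (h.coeff_ne_zero 0) (h.rep_ne_zero _ (hPX M) 0) this.symm
    refine ⟨by rw [← hP M]; exact hne, hne, ?_⟩
    simp only [← hP M, twistedForm]
  · rw [← linForm_apply]
    exact h.annihilates _ (hle (h.rep_mem _ (hPX M)))

/-- A further point R of X completes the forms of S to a basis of the dual space, so a vector killed
by the forms of S is determined by its value under the form of R. -/
theorem eq_smul_prod (h : PointsOnLine W a X) (hX : m + 1 < X.card)
    {S : Finset (PSpace (m + 1))} (hS : S ⊆ X) (hcard : S.card = m + 1)
    {v : Fin (m + 1 + 1) → ℂ} (hv : ∀ P ∈ S, twistedForm a P.rep v = 0) :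
    ∃ c : ℂ, c • ∏ Q ∈ S, Q.rep = v := by
  classical
  obtain ⟨R, hRX, hRS⟩ := Finset.exists_mem_notMem_of_card_lt_card (hcard.trans_lt hX)
  have hR := h.form_prod_ne_zero hS hcard hRX hRS
  set x := ∏ Q ∈ S, Q.rep with hx
  -- This scalar makes the form of R vanish on y as well.
  refine ⟨twistedForm a R.rep v / twistedForm a R.rep x, ?_⟩
  set y := (twistedForm a R.rep v / twistedForm a R.rep x) • x - v with hy
  have hind := h.linearIndepOn_form (S := insert R S) (Finset.insert_subset hRX hS)
    (by rw [Finset.card_insert_of_notMem hRS, hcard])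
  have hspan := LinearIndependent.span_eq_top_of_card_eq_finrank' hind
    (by simp [Finset.card_insert_of_notMem hRS, hcard])
  have hkill : ∀ f : LinForm (m + 1), f y = 0 := by
    intro f
    have hf : f ∈ Submodule.span ℂ (Set.range fun P : ((insert R S : Finset (PSpace (m + 1))) :
        Set (PSpace (m + 1))) => twistedForm a P.1.rep) := hspan ▸ Submodule.mem_top
    induction hf using Submodule.span_induction with
    | mem f hf =>
      obtain ⟨⟨P, hP⟩, rfl⟩ := hf
      rcases Finset.mem_insert.1 hP with rfl | hP
      · simp [hy, div_mul_cancel₀ _ hR]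
      · simp [hy, hv P hP, hx, h.form_prod_eq_zero hS hcard hP]
    | zero => simp
    | add f g _ _ hf hg => simp [hf, hg]
    | smul c f _ hf => simp [hf]
  exact sub_eq_zero.1 ((Module.forall_dual_apply_eq_zero_iff ℂ y).1 hkill)

theorem sqFreeHadamardPower_eq (h : PointsOnLine W a X) (hX : m + 1 < X.card) :
    sqFreeHadamardPower (X : Set (PSpace (m + 1))) (m + 1) = starVariety (m + 1) (forms a X) := by
  classical
  ext Z
  simp only [sqFreeHadamardPower, IsHadamardProduct, starVariety, Set.mem_ofPred_eq,
    Set.mem_iUnion, Finset.mem_powersetCard, exists_prop, zeroLocus]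
  constructor
  · rintro ⟨P, hinj, hPX, hne, rfl⟩
    have hS : Finset.univ.image P ⊆ X := by
      intro Q hQ
      obtain ⟨i, -, rfl⟩ := Finset.mem_image.1 hQ
      exact hPX i
    have hcard : (Finset.univ.image P).card = m + 1 := by
      rw [Finset.card_image_of_injective _ hinj]; simp
    refine ⟨forms a (Finset.univ.image P), ⟨Finset.image_subset_image hS, ?_⟩, ?_⟩
    · rw [forms, Finset.card_image_of_injOn (h.form_injOn.mono hS), hcard]
    · intro L hL
      obtain ⟨Q, hQ, rfl⟩ := Finset.mem_image.1 hL
      obtain ⟨c, hc⟩ := Projectivization.exists_smul_eq_mk_rep ℂ _ hne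
      have hzero := h.form_prod_eq_zero hS hcard hQ
      rw [Finset.prod_image hinj.injOn] at hzero
      have hfun : (fun j => ∏ i, (P i).rep j) = ∏ i, (P i).rep := by
        funext j; rw [Finset.prod_apply]
      rw [← hc, Units.smul_def, map_smul, hfun, hzero, smul_zero]
  · rintro ⟨T, ⟨hT, hTcard⟩, hZ⟩
    obtain ⟨S, hS, hST, rfl⟩ := h.exists_subset_of_subset_forms hT
    have hcard := hST.trans hTcard
    obtain ⟨c, hc⟩ := h.eq_smul_prod hX hS hcard fun P hP => hZ _ (Finset.mem_image_of_mem _ hP)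
    let g := (S.equivFinOfCardEq hcard).symm
    have hfun : (fun j => ∏ i, ((g i : S) : PSpace (m + 1)).rep j) = ∏ Q ∈ S, Q.rep := by
      funext j
      rw [Finset.prod_apply, ← Finset.prod_coe_sort S fun Q => Q.rep j,
        ← g.prod_comp fun Q : S => (Q : PSpace (m + 1)).rep j]
    have hne : (fun j => ∏ i, ((g i : S) : PSpace (m + 1)).rep j) ≠ 0 := by
      intro h0
      have := congrFun h0 0
      rw [Pi.zero_apply, Finset.prod_eq_zero_iff] at this
      obtain ⟨i, -, hi⟩ := this
      exact h.rep_ne_zero _ (hS (g i).2) 0 hi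
    refine ⟨fun i => g i, Subtype.val_injective.comp g.injective, fun i => hS (g i).2, hne, ?_⟩
    rw [← Z.mk_rep, Projectivization.mk_eq_mk_iff']
    exact ⟨c, by rw [hfun, hc]⟩

theorem isHadamardStarConfiguration (h : PointsOnLine W a X) (hX : m + 1 < X.card)
    (hle : W ≤ W ^ m) :
    IsHadamardStarConfiguration (sqFreeHadamardPower (X : Set (PSpace (m + 1))) (m + 1)) :=
  ⟨m + 1, forms a X, Nat.le_add_left _ _, le_rfl, h.generallyLinear hX,
    h.isStrongHadamardSet hle, h.sqFreeHadamardPower_eq hX⟩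

end PointsOnLine

/-! ### From projective hypotheses to coordinates -/

theorem avoidsCodimTwo_of_inter_coordDelta {n : ℕ}
    {ℓ : Projectivization.Subspace ℂ (Fin (n + 1) → ℂ)}
    (hΔ : (ℓ : Set (PSpace n)) ∩ coordDelta n ((n : ℤ) - 2) = ∅) :
    AvoidsCodimTwo (Projectivization.Subspace.submodule ℓ) := by
  classical
  intro w hw hw0 j k hjk hj hk
  refine Set.eq_empty_iff_forall_notMem.1 hΔ (Projectivization.mk ℂ w hw0)
    ⟨(Projectivization.Subspace.mem_submodule_iff ℓ hw0).1 hw, ?_⟩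
  obtain ⟨c, hc⟩ := Projectivization.exists_smul_eq_mk_rep ℂ w hw0
  simp only [coordDelta, Set.mem_ofPred_eq]
  rw [Finset.filter_congr_decidable, ← hc]
  have hsub : (Finset.univ.filter fun i => (c • w) i ≠ 0) ⊆ (Finset.univ.erase j).erase k := by
    intro i hi
    simp only [Finset.mem_filter, Finset.mem_univ, true_and] at hi
    simp only [Finset.mem_erase, Finset.mem_univ, and_true]
    constructor <;> rintro rfl <;> exact hi (by simp [*])
  have hcard := Finset.card_le_card hsub
  rw [Finset.card_erase_of_mem (by simpa using hjk.symm),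
    Finset.card_erase_of_mem (Finset.mem_univ _), Finset.card_univ, Fintype.card_fin] at hcard
  -- Two distinct indices force n ≥ 1, so the truncated n + 1 - 1 - 1 agrees with the integer n - 2
  -- + 1.
  have hn : 1 ≤ n := by
    have := j.2; have := k.2
    by_contra hn
    exact hjk (Fin.ext (by omega))
  omega

theorem rep_ne_zero_of_notMem_coordDelta {n : ℕ} {P : PSpace n}
    (hP : P ∉ coordDelta n ((n : ℤ) - 1)) (j : Fin (n + 1)) : P.rep j ≠ 0 := by
  classical
  intro hj
  refine hP ?_
  simp only [coordDelta, Set.mem_ofPred_eq]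
  rw [Finset.filter_congr_decidable]
  have hsub : (Finset.univ.filter fun i => P.rep i ≠ 0) ⊆ Finset.univ.erase j := by
    intro i hi
    simp only [Finset.mem_filter, Finset.mem_univ, true_and] at hi
    simp only [Finset.mem_erase, Finset.mem_univ, and_true]
    rintro rfl
    exact hi hj
  have hcard := Finset.card_le_card hsub
  rw [Finset.card_erase_of_mem (Finset.mem_univ _), Finset.card_univ, Fintype.card_fin] at hcard
  omega

end HadamardStar

theorem theorem2 (n : ℕ) (hn : 2 ≤ n)
    (ℓ : Projectivization.Subspace ℂ (Fin (n + 1) → ℂ)) (hℓ : HadamardStar.IsLine ℓ)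
    (hΔ : (ℓ : Set (HadamardStar.PSpace n)) ∩ HadamardStar.coordDelta n ((n : ℤ) - 2) = ∅)
    (X : Finset (HadamardStar.PSpace n))
    (hXℓ : (X : Set (HadamardStar.PSpace n)) ⊆ (ℓ : Set (HadamardStar.PSpace n)))
    (hm : n < X.card)
    (hXΔ : (X : Set (HadamardStar.PSpace n)) ∩ HadamardStar.coordDelta n ((n : ℤ) - 1) = ∅) :
    (HadamardStar.onesPoint n ∈ ℓ →
      HadamardStar.IsHadamardStarConfiguration
        (HadamardStar.sqFreeHadamardPower (X : Set (HadamardStar.PSpace n)) n)) ∧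
    (n = 2 →
      HadamardStar.IsHadamardStarConfiguration
        (HadamardStar.sqFreeHadamardPower (X : Set (HadamardStar.PSpace n)) 2)) := by
  obtain ⟨m, rfl⟩ : ∃ m, n = m + 1 := ⟨n - 1, by omega⟩
  set W := Projectivization.Subspace.submodule ℓ with hW
  have hA := HadamardStar.avoidsCodimTwo_of_inter_coordDelta hΔ
  obtain ⟨a, ha, ha0⟩ := hA.exists_annihilator hℓ
  have h : HadamardStar.PointsOnLine W a X :=
    { finrank := hℓ
      avoids := hA
      annihilates := ha
      coeff_ne_zero := ha0
      rep_mem := fun P hP => (Projectivization.Subspace.mem_submodule_iff ℓ P.rep_nonzero).2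
        (by rw [P.mk_rep]; exact hXℓ hP)
      rep_ne_zero := fun P hP => HadamardStar.rep_ne_zero_of_notMem_coordDelta
        fun hPΔ => Set.eq_empty_iff_forall_notMem.1 hXΔ P ⟨hP, hPΔ⟩ }
  constructor
  · intro hones
    refine h.isHadamardStarConfiguration hm ?_
    -- The all-ones vector is the unit of the entrywise product, so the powers of W increase.
    have h1 : (1 : Submodule ℂ (Fin (m + 1 + 1) → ℂ)) ≤ W := by
      rw [Submodule.one_le]
      exact (Projectivization.Subspace.mem_submodule_iff ℓ one_ne_zero).2 hones
    calc W = W ^ 1 := (pow_one W).symm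
      _ ≤ W ^ m := pow_le_pow_right₀ h1 (by omega)
  · intro h2
    obtain rfl : m = 1 := by omega
    exact h.isHadamardStarConfiguration hm (pow_one W).ge
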